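/- A partition is a $t$-core if none of the hook lengths of its Young diagram is a multiple of $t$. For $n\ge 0$ let $A_3(n)$ denote the number of ordered pairs $(\lambda_1,\lambda_2)$ of partitions (the empty partition being allowed) such that $\lambda_1$ and $\lambda_2$ are both $3$-cores and the sum of all parts of $\lambda_1$ and $\lambda_2$ equals $n$. Let $p$ be a prime and let $k,n$ be nonnegative integers. (1) If $p\equiv 1 \pmod 3$, then \[A_{3}\Big(p^kn+\frac{2p^{k}-2}{3}\Big)=\frac{p^{k}-1}{p-1}\,A_{3}\Big(pn+\frac{2p-2}{3}\Big)-\frac{p^{k}-p}{p-1}\,A_{3}(n).\] (2) If $p\equiv 2 \pmod 3$, then \[A_{3}\Big(p^{2k}n+\frac{2p^{2k}-2}{3}\Big)=\frac{p^{2k}-1}{p^2-1}\,A_{3}\Big(p^2n+\frac{2p^2-2}{3}\Big)-\frac{p^{2k}-p^2}{p^2-1}\,A_{3}(n).\] -/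

import Mathlib

/-- The hook length of the cell `(i, j)` of a Young diagram: the number of cells to its right in
its row, plus the number of cells below it in its column, plus one for the cell itself. -/
def YoungDiagram.hookLength (μ : YoungDiagram) (i j : ℕ) : ℕ :=
  (μ.rowLen i - (j + 1)) + (μ.colLen j - (i + 1)) + 1

/-- A partition (given by its Young diagram) is a `t`-core if none of the hook lengths of its cells
is a multiple of `t`. -/
def YoungDiagram.IsCore (t : ℕ) (μ : YoungDiagram) : Prop :=
  ∀ i j : ℕ, (i, j) ∈ μ → ¬ t ∣ μ.hookLength i j

/-- The (ordered) pairs of partitions of total size `n` in which both partitions are `t`-cores.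
The empty partition is allowed. -/
def corePairs (t n : ℕ) : Set (YoungDiagram × YoungDiagram) :=
  {P | P.1.card + P.2.card = n ∧ P.1.IsCore t ∧ P.2.IsCore t}

/-- `A_t(n)`: the number of partition pairs of `n` with `t`-cores. The set counted is finite, see
`corePairs_finite`. -/
noncomputable def numCorePairs (t n : ℕ) : ℕ := (corePairs t n).ncard

theorem YoungDiagram.cells_subset_of_card_le {μ : YoungDiagram} {n : ℕ} (h : μ.card ≤ n) :
    μ.cells ⊆ Finset.range n ×ˢ Finset.range n := by
  rintro ⟨i, j⟩ hc
  have hc' : (i, j) ∈ μ := hc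
  have h1 : i < μ.colLen j := YoungDiagram.mem_iff_lt_colLen.1 hc'
  have h2 : j < μ.rowLen i := YoungDiagram.mem_iff_lt_rowLen.1 hc'
  have h3 : μ.colLen j ≤ μ.card := by
    rw [YoungDiagram.colLen_eq_card]
    exact Finset.card_le_card (Finset.filter_subset _ _)
  have h4 : μ.rowLen i ≤ μ.card := by
    rw [YoungDiagram.rowLen_eq_card]
    exact Finset.card_le_card (Finset.filter_subset _ _)
  simp only [Finset.mem_product, Finset.mem_range]
  omega

theorem YoungDiagram.finite_card_le (n : ℕ) : {μ : YoungDiagram | μ.card ≤ n}.Finite := by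
  refine Set.Finite.of_finite_image (f := YoungDiagram.cells) ?_
    (fun μ _ ν _ h => YoungDiagram.ext h)
  refine Set.Finite.subset
    (Finset.finite_toSet (Finset.range n ×ˢ Finset.range n).powerset) ?_
  rintro _ ⟨μ, hμ, rfl⟩
  exact Finset.mem_coe.2 (Finset.mem_powerset.2 (YoungDiagram.cells_subset_of_card_le hμ))

theorem corePairs_finite (t n : ℕ) : (corePairs t n).Finite := by
  refine Set.Finite.subset
    ((YoungDiagram.finite_card_le n).prod (YoungDiagram.finite_card_le n)) ?_
  rintro ⟨μ, ν⟩ ⟨h, -, -⟩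
  have h' : μ.card + ν.card = n := h
  constructor
  · change μ.card ≤ n
    omega
  · change ν.card ≤ n
    omega

/-!
The idea is that `3 * A₃(n) = σ(3 * n + 2)`. Both parts of the theorem then express the Hecke
recursion `σ(p² * N) = (1 + p) * σ(p * N) - p * σ(N)` at `N = 3 * n + 2`, solved along the powers
of `p`.

A `3`-core is determined by its set of first-column hook lengths, which is closed under subtracting
`3` and omits `0`, hence by the numbers `a` and `b` of its elements congruent to `1` and `2` modulo
`3`; its size is then `a² - a * b + b² + b`. All integral solutions of `a² - a * b + b² + b = n`
correspond to the Eisenstein integers of norm `3 * n + 1` up to sign, and an order three rotation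
permutes them with the quadrant `0 ≤ a`, `0 ≤ b` as a fundamental domain. Unique factorization in
the Eisenstein integers thus shows that the number of `3`-cores of size `n` is the sum of `(d / 3)`
over the divisors `d` of `3 * n + 1`. Finally, the convolution of this divisor sum with itself is
evaluated by Liouville's elementary identity, applied to the indicator function of `3 ∣ z`.
-/

open Finset YoungDiagram
open ArithmeticFunction (sigma)

section DivisorSums

variable {R : Type*} [CommSemiring R] {h : ℕ → R} {p M : ℕ}

theorem filter_dvd_divisors_mul (hp : p ≠ 0) :
    {d ∈ (p * M).divisors | p ∣ d} = M.divisors.image (p * ·) := by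
  ext d
  simp only [mem_filter, mem_image, Nat.mem_divisors, mul_ne_zero_iff]
  constructor
  · rintro ⟨⟨hd, -, hM⟩, e, rfl⟩
    exact ⟨e, ⟨Nat.dvd_of_mul_dvd_mul_left hp.bot_lt hd, hM⟩, rfl⟩
  · rintro ⟨e, ⟨he, hM⟩, rfl⟩
    exact ⟨⟨Nat.mul_dvd_mul_left p he, hp, hM⟩, dvd_mul_right p e⟩

theorem filter_not_dvd_divisors_prime_mul (hp : p.Prime) :
    {d ∈ (p * M).divisors | ¬p ∣ d} = {d ∈ M.divisors | ¬p ∣ d} := by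
  ext d
  simp only [mem_filter, Nat.mem_divisors, mul_ne_zero_iff, hp.ne_zero, ne_eq, not_false_eq_true,
    true_and, and_congr_left_iff]
  intro hpd _
  exact ((hp.coprime_iff_not_dvd.2 hpd).symm).dvd_mul_left

theorem sum_filter_dvd_divisors_mul (hmul : ∀ a b, h (a * b) = h a * h b) (hp : p ≠ 0) :
    ∑ d ∈ (p * M).divisors with p ∣ d, h d = h p * ∑ d ∈ M.divisors, h d := by
  rw [filter_dvd_divisors_mul hp, sum_image fun _ _ _ _ => Nat.eq_of_mul_eq_mul_left hp.bot_lt]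
  simp only [hmul, mul_sum]

theorem sum_divisors_prime_mul (hmul : ∀ a b, h (a * b) = h a * h b) (hp : p.Prime) :
    ∑ d ∈ (p * M).divisors, h d =
      h p * ∑ d ∈ M.divisors, h d + ∑ d ∈ M.divisors with ¬p ∣ d, h d := by
  rw [← sum_filter_dvd_divisors_mul hmul hp.ne_zero, ← filter_not_dvd_divisors_prime_mul hp,
    sum_filter_add_sum_filter_not]

theorem sum_divisors_prime_mul_of_not_dvd (hmul : ∀ a b, h (a * b) = h a * h b) (hp : p.Prime)
    (hM : ¬p ∣ M) : ∑ d ∈ (p * M).divisors, h d = (1 + h p) * ∑ d ∈ M.divisors, h d := by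
  rw [sum_divisors_prime_mul hmul hp,
    filter_true_of_mem fun _ hd => mt (Dvd.dvd.trans · (Nat.dvd_of_mem_divisors hd)) hM]
  ring

theorem sum_divisors_prime_mul_prime_mul (hmul : ∀ a b, h (a * b) = h a * h b) (hp : p.Prime) :
    ∑ d ∈ (p * (p * M)).divisors, h d + h p * ∑ d ∈ M.divisors, h d =
      (1 + h p) * ∑ d ∈ (p * M).divisors, h d := by
  rw [sum_divisors_prime_mul hmul hp, filter_not_dvd_divisors_prime_mul hp,
    sum_divisors_prime_mul hmul hp]
  ring

theorem sigma_one_prime_pow_mul (hp : p.Prime) (N k : ℕ) :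
    ((p : ℚ) - 1) * sigma 1 (p ^ k * N) =
      ((p : ℚ) ^ k - 1) * sigma 1 (p * N) - ((p : ℚ) ^ k - p) * sigma 1 N := by
  induction k using Nat.twoStepInduction with
  | zero =>
    simp only [pow_zero, one_mul]
    ring
  | one => simp only [pow_one, sub_self, zero_mul, sub_zero]
  | more k ih ih' =>
    have hecke : (sigma 1 (p ^ (k + 2) * N) + p * sigma 1 (p ^ k * N) : ℚ) =
        (1 + p) * sigma 1 (p ^ (k + 1) * N) := by
      simp only [ArithmeticFunction.sigma_one_apply, Nat.cast_sum, pow_succ', mul_assoc]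
      exact sum_divisors_prime_mul_prime_mul Nat.cast_mul hp
    linear_combination ((p : ℚ) - 1) * hecke + (1 + (p : ℚ)) * ih' - (p : ℚ) * ih

theorem sigma_one_prime_pow_pow_mul (hp : p.Prime) {j : ℕ} (hj : j ≠ 0) (N k : ℕ) :
    (sigma 1 ((p ^ j) ^ k * N) : ℚ) =
      (((p : ℚ) ^ j) ^ k - 1) / ((p : ℚ) ^ j - 1) * sigma 1 (p ^ j * N) -
        (((p : ℚ) ^ j) ^ k - (p : ℚ) ^ j) / ((p : ℚ) ^ j - 1) * sigma 1 N := by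
  have hp1 : (1 : ℚ) < p := mod_cast hp.one_lt
  have hne : (p : ℚ) - 1 ≠ 0 := (sub_pos.2 hp1).ne'
  have hne' : (p : ℚ) ^ j - 1 ≠ 0 := (sub_pos.2 (one_lt_pow₀ hp1 hj)).ne'
  have hjk := sigma_one_prime_pow_mul hp N (j * k)
  rw [pow_mul, pow_mul] at hjk
  field_simp
  apply mul_left_cancel₀ hne
  linear_combination ((p : ℚ) ^ j - 1) * hjk -
    (((p : ℚ) ^ j) ^ k - 1) * sigma_one_prime_pow_mul hp N j

end DivisorSums

section LegendreThree

theorem legendreSym_three_eq_one {d : ℕ} (hd : d % 3 = 1) : legendreSym 3 d = 1 := by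
  rw [legendreSym.mod, show (d : ℤ) % (3 : ℕ) = 1 by omega, legendreSym.at_one]

theorem legendreSym_three_eq_neg_one {d : ℕ} (hd : d % 3 = 2) : legendreSym 3 d = -1 := by
  rw [legendreSym.mod, show (d : ℤ) % (3 : ℕ) = 2 by omega]
  decide

theorem sum_divisors_legendreSym_three_eq_zero {N : ℕ} (hN : N % 3 = 2) :
    ∑ d ∈ N.divisors, legendreSym 3 d = 0 := by
  have reflect : ∑ d ∈ N.divisors, legendreSym 3 (N / d : ℕ) =
      -∑ d ∈ N.divisors, legendreSym 3 d := by
    rw [← sum_neg_distrib]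
    refine sum_congr rfl fun d hd => ?_
    have hmul : legendreSym 3 d * legendreSym 3 (N / d : ℕ) = -1 := by
      rw [← legendreSym.mul, ← Nat.cast_mul, Nat.mul_div_cancel' (Nat.dvd_of_mem_divisors hd),
        legendreSym_three_eq_neg_one hN]
    rcases Int.eq_one_or_neg_one_of_mul_eq_neg_one hmul with h | h <;> rw [h] at hmul ⊢ <;> linarith
  rw [Nat.sum_div_divisors N fun d => legendreSym 3 d] at reflect
  linarith

end LegendreThree

section Liouville

/-- The quadruples `((a, x), (b, y))` of positive integers with `a * x + b * y = N`. -/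
def mulAddQuads (N : ℕ) : Finset ((ℕ × ℕ) × (ℕ × ℕ)) :=
  (antidiagonal N).biUnion fun q => q.1.divisorsAntidiagonal ×ˢ q.2.divisorsAntidiagonal

/-- The sum of `f a x b y` over the positive solutions of `a * x + b * y = N`. Restrictions on the
solutions are put into `f` by means of `if … then … else 0`. -/
def quadSum {R : Type*} [AddCommMonoid R] (N : ℕ) (f : ℕ → ℕ → ℕ → ℕ → R) : R :=
  ∑ t ∈ mulAddQuads N, f t.1.1 t.1.2 t.2.1 t.2.2

theorem mem_mulAddQuads {N a x b y : ℕ} :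
    ((a, x), (b, y)) ∈ mulAddQuads N ↔ 0 < a ∧ 0 < x ∧ 0 < b ∧ 0 < y ∧ a * x + b * y = N := by
  simp only [mulAddQuads, mem_biUnion, mem_product, Nat.mem_divisorsAntidiagonal,
    HasAntidiagonal.mem_antidiagonal, Prod.exists]
  constructor
  · rintro ⟨i, j, rfl, ⟨rfl, hax⟩, rfl, hby⟩
    simp only [mul_ne_zero_iff, ← Nat.pos_iff_ne_zero] at hax hby
    exact ⟨hax.1, hax.2, hby.1, hby.2, rfl⟩
  · rintro ⟨ha, hx, hb, hy, rfl⟩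
    exact ⟨a * x, b * y, rfl, ⟨rfl, by positivity⟩, rfl, by positivity⟩

section AddCommMonoid

variable {R : Type*} [AddCommMonoid R] {N : ℕ} {f g : ℕ → ℕ → ℕ → ℕ → R}

theorem quadSum_congr (h : ∀ a x b y, a * x + b * y = N → f a x b y = g a x b y) :
    quadSum N f = quadSum N g :=
  sum_congr rfl fun _ ht => h _ _ _ _ (mem_mulAddQuads.1 ht).2.2.2.2

theorem quadSum_add :
    quadSum N (fun a x b y => f a x b y + g a x b y) = quadSum N f + quadSum N g :=
  sum_add_distrib

theorem quadSum_swap : quadSum N f = quadSum N fun a x b y => f b y a x := by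
  refine sum_nbij' Prod.swap Prod.swap ?_ ?_ (fun _ _ => rfl) (fun _ _ => rfl) (fun _ _ => rfl) <;>
  · rintro ⟨⟨a, x⟩, b, y⟩ h
    rw [mem_mulAddQuads] at h
    rw [Prod.swap_prod_mk, mem_mulAddQuads]
    exact ⟨h.2.2.1, h.2.2.2.1, h.1, h.2.1, add_comm (b * y) _ ▸ h.2.2.2.2⟩

theorem quadSum_transpose : quadSum N f = quadSum N fun a x b y => f x a y b := by
  refine sum_nbij' (Prod.map Prod.swap Prod.swap) (Prod.map Prod.swap Prod.swap) ?_ ?_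
    (fun _ _ => rfl) (fun _ _ => rfl) (fun _ _ => rfl) <;>
  · rintro ⟨⟨a, x⟩, b, y⟩ h
    rw [mem_mulAddQuads] at h
    rw [Prod.map, Prod.swap_prod_mk, Prod.swap_prod_mk, mem_mulAddQuads, mul_comm x, mul_comm y]
    exact ⟨h.2.1, h.1, h.2.2.2.1, h.2.2.1, h.2.2.2.2⟩

/-- The substitution rests on `a * x + b * y = (a + b) * x + b * (y - x)`. -/
theorem quadSum_shear (f : ℕ → ℕ → ℕ → ℕ → R) :
    quadSum N (fun a x b y => if x < y then f (a + b) x b (y - x) else 0) =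
      quadSum N fun a x b y => if b < a then f a x b y else 0 := by
  simp only [quadSum, ← sum_filter]
  refine sum_nbij' (fun t => ((t.1.1 + t.2.1, t.1.2), (t.2.1, t.2.2 - t.1.2)))
    (fun t => ((t.1.1 - t.2.1, t.1.2), (t.2.1, t.1.2 + t.2.2))) ?_ ?_ ?_ ?_ (fun _ _ => rfl)
  · rintro ⟨⟨a, x⟩, b, y⟩ h
    simp only [mem_filter, mem_mulAddQuads] at h ⊢
    obtain ⟨⟨ha, hx, hb, -, rfl⟩, hxy⟩ := h
    obtain ⟨z, rfl⟩ := Nat.exists_eq_add_of_lt hxy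
    refine ⟨⟨by omega, hx, hb, by omega, ?_⟩, by omega⟩
    rw [show x + z + 1 - x = z + 1 by omega]
    ring
  · rintro ⟨⟨a, x⟩, b, y⟩ h
    simp only [mem_filter, mem_mulAddQuads] at h ⊢
    obtain ⟨⟨-, hx, hb, hy, rfl⟩, hba⟩ := h
    obtain ⟨c, rfl⟩ := Nat.exists_eq_add_of_lt hba
    refine ⟨⟨by omega, hx, hb, by omega, ?_⟩, by omega⟩
    rw [show b + c + 1 - b = c + 1 by omega]
    ring
  all_goals
    rintro ⟨⟨a, x⟩, b, y⟩ h
    have hlt := (mem_filter.1 h).2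
    simp only [Prod.mk.injEq, true_and, and_true] at hlt ⊢
    omega

theorem quadSum_diagonal (g : ℕ → ℕ → ℕ → R) :
    quadSum N (fun a x b y => if x = y then g a b x else 0) =
      ∑ d ∈ N.divisors, ∑ l ∈ Ico 1 d, g l (d - l) (N / d) := by
  rw [quadSum, ← sum_filter, sum_sigma']
  refine sum_nbij' (fun t => ⟨t.1.1 + t.2.1, t.1.1⟩)
    (fun s => ((s.2, N / s.1), (s.1 - s.2, N / s.1))) ?_ ?_ ?_ ?_ ?_
  · rintro ⟨⟨a, x⟩, b, y⟩ h
    simp only [mem_filter, mem_mulAddQuads] at h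
    obtain ⟨⟨ha, hx, hb, -, rfl⟩, rfl⟩ := h
    simp only [mem_sigma, Nat.mem_divisors, mem_Ico]
    exact ⟨⟨⟨x, (add_mul a b x).symm⟩, by positivity⟩, ha, by omega⟩
  · rintro ⟨d, l⟩ h
    simp only [mem_sigma, Nat.mem_divisors, mem_Ico] at h
    obtain ⟨⟨⟨x, rfl⟩, hN⟩, hl, hld⟩ := h
    rw [mul_ne_zero_iff, ← Nat.pos_iff_ne_zero, ← Nat.pos_iff_ne_zero] at hN
    simp only [mem_filter, mem_mulAddQuads, and_true, Nat.mul_div_cancel_left x hN.1, ← add_mul]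
    exact ⟨hl, hN.2, by omega, hN.2, by rw [Nat.add_sub_of_le hld.le]⟩
  · rintro ⟨⟨a, x⟩, b, y⟩ h
    simp only [mem_filter, mem_mulAddQuads] at h
    obtain ⟨⟨ha, -, -, -, rfl⟩, rfl⟩ := h
    simp only [← add_mul, Nat.mul_div_cancel_left x (Nat.add_pos_left ha b), add_tsub_cancel_left]
  · rintro ⟨d, l⟩ h
    simp only [mem_sigma, mem_Ico] at h
    simp only [Nat.add_sub_of_le h.2.2.le]
  · rintro ⟨⟨a, x⟩, b, y⟩ h
    simp only [mem_filter, mem_mulAddQuads] at h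
    obtain ⟨⟨ha, -, -, -, rfl⟩, rfl⟩ := h
    simp only [← add_mul, Nat.mul_div_cancel_left x (Nat.add_pos_left ha b), add_tsub_cancel_left]

theorem quadSum_trichotomy (u v : ℕ → ℕ → ℕ → ℕ → ℕ) (f : ℕ → ℕ → ℕ → ℕ → R) :
    quadSum N f = quadSum N (fun a x b y => if u a x b y = v a x b y then f a x b y else 0) +
      quadSum N (fun a x b y => if u a x b y < v a x b y then f a x b y else 0) +
      quadSum N (fun a x b y => if v a x b y < u a x b y then f a x b y else 0) := by
  rw [← quadSum_add, ← quadSum_add]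
  refine quadSum_congr fun a x b y _ => ?_
  rcases lt_trichotomy (u a x b y) (v a x b y) with h | h | h
  · simp [h, h.ne, h.not_gt]
  · simp [h]
  · simp [h, h.ne', h.not_gt]

end AddCommMonoid

theorem quadSum_mul {R : Type*} [CommSemiring R] (N : ℕ) (f g : ℕ → R) :
    quadSum N (fun a _ b _ => f a * g b) =
      ∑ q ∈ antidiagonal N, (∑ d ∈ q.1.divisors, f d) * ∑ d ∈ q.2.divisors, g d := by
  rw [quadSum, mulAddQuads, sum_biUnion]
  · refine sum_congr rfl fun q _ => ?_
    rw [← Nat.sum_divisorsAntidiagonal fun d _ => f d,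
      ← Nat.sum_divisorsAntidiagonal fun d _ => g d, sum_mul_sum, sum_product]
  · intro q _ q' _ hne
    refine disjoint_left.2 fun t ht ht' => hne ?_
    simp only [mem_product, Nat.mem_divisorsAntidiagonal] at ht ht'
    exact Prod.ext (ht.1.1.symm.trans ht'.1.1) (ht.2.1.symm.trans ht'.2.1)

section CommRing

variable {R : Type*} [CommRing R] {F : ℤ → R}

theorem quadSum_apply_sub (hF : F.Even) (N : ℕ) :
    quadSum N (fun a _ b _ => F (a - b)) =
      quadSum N (fun a _ b _ => if a = b then F 0 else 0) +
        2 * quadSum N (fun a x _ y => if x < y then F a else 0) := by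
  have shear := quadSum_shear (N := N) fun a _ b _ => F (a - b)
  simp only [Nat.cast_add, add_sub_cancel_right] at shear
  have diag : quadSum N (fun a _ b _ => if a = b then F (a - b) else 0) =
      quadSum N fun a _ b _ => if a = b then F 0 else 0 :=
    quadSum_congr fun a _ b _ _ => by split_ifs with hab <;> simp [hab]
  have swap : quadSum N (fun a _ b _ => if a < b then F (a - b) else 0) =
      quadSum N fun a _ b _ => if b < a then F (a - b) else 0 := by
    rw [quadSum_swap]
    exact quadSum_congr fun a _ b _ _ => by rw [← hF (b - a : ℤ), neg_sub]
  rw [quadSum_trichotomy (fun a _ _ _ => a) (fun _ _ b _ => b), diag, swap, shear]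
  ring

theorem quadSum_apply_add (F : ℤ → R) (N : ℕ) :
    quadSum N (fun a _ b _ => F (a + b)) =
      quadSum N (fun a x b y => if x = y then F (a + b) else 0) +
        2 * quadSum N (fun a _ b _ => if b < a then F a else 0) := by
  have shear := quadSum_shear (N := N) fun a _ _ _ => F a
  simp only [Nat.cast_add] at shear
  have swap : quadSum N (fun a x b y => if y < x then F (a + b) else 0) =
      quadSum N fun a x b y => if x < y then F (a + b) else 0 := by
    rw [quadSum_swap]
    exact quadSum_congr fun a _ b _ _ => by rw [add_comm (a : ℤ)]
  rw [quadSum_trichotomy (fun _ x _ _ => x) (fun _ _ _ y => y), swap, shear]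
  ring

theorem quadSum_lt_add_quadSum_eq (F : ℤ → R) (N : ℕ) :
    quadSum N (fun a x _ y => if x < y then F a else 0) +
        quadSum N (fun a x _ y => if x = y then F a else 0) =
      quadSum N (fun a _ b _ => if b < a then F a else 0) +
        quadSum N (fun a _ b _ => if a = b then F a else 0) := by
  have shear := quadSum_shear (N := N) fun _ _ b _ => F b
  have swap_args := quadSum_swap (N := N) (f := fun a _ b _ => if b < a then F b else 0)
  have swap_cofactors := quadSum_swap (N := N) (f := fun _ x b y => if x < y then F b else 0)
  have by_args := quadSum_trichotomy (N := N) (fun a _ _ _ => a) (fun _ _ b _ => b)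
    fun a _ _ _ => F a
  have by_cofactors := quadSum_trichotomy (N := N) (fun _ x _ _ => x) (fun _ _ _ y => y)
    fun a _ _ _ => F a
  linear_combination by_args - by_cofactors - swap_args + swap_cofactors - shear

theorem liouville_identity (hF : F.Even) (N : ℕ) :
    quadSum N (fun a _ b _ => F (a - b)) - quadSum N (fun a _ b _ => F (a + b)) =
      ∑ d ∈ N.divisors, ∑ l ∈ Ico 1 d, (F 0 + 2 * F (N / d : ℕ) - F d - 2 * F l) := by
  have hargs := quadSum_transpose (N := N) (f := fun a _ b _ => if a = b then F a else 0)
  have hzero := quadSum_transpose (N := N) (f := fun a _ b _ => if a = b then F 0 else 0)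
  rw [quadSum_diagonal fun _ _ x => F x] at hargs
  rw [quadSum_diagonal fun _ _ _ => F 0] at hzero
  have hcof := quadSum_diagonal (N := N) fun a _ _ => F a
  have hadd := quadSum_diagonal (N := N) fun a b _ => F (a + b)
  have hd : ∑ d ∈ N.divisors, ∑ l ∈ Ico 1 d, F (l + (d - l : ℕ)) =
      ∑ d ∈ N.divisors, ∑ _l ∈ Ico 1 d, F d :=
    sum_congr rfl fun d _ => sum_congr rfl fun l hl => by
      rw [← Nat.cast_add, Nat.add_sub_of_le (mem_Ico.1 hl).2.le]
  simp only [sum_add_distrib, sum_sub_distrib, ← mul_sum]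
  linear_combination quadSum_apply_sub hF N - quadSum_apply_add F N +
    2 * quadSum_lt_add_quadSum_eq F N + hzero + 2 * hargs - hadd - 2 * hcof - hd

end CommRing

theorem legendreSym_three_mul_eq_ite_sub_ite (a b : ℕ) :
    legendreSym 3 a * legendreSym 3 b =
      (if (3 : ℤ) ∣ a - b then 1 else 0) - if (3 : ℤ) ∣ a + b then 1 else 0 := by
  have hz : ∀ {d : ℕ}, d % 3 = 0 → legendreSym 3 d = 0 := fun {d} hd => by
    rw [legendreSym.mod, show (d : ℤ) % (3 : ℕ) = 0 by omega, legendreSym.at_zero]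
  have ha : a % 3 = 0 ∨ a % 3 = 1 ∨ a % 3 = 2 := by omega
  have hb : b % 3 = 0 ∨ b % 3 = 1 ∨ b % 3 = 2 := by omega
  rcases ha with ha | ha | ha <;> rcases hb with hb | hb | hb <;>
    simp only [hz, legendreSym_three_eq_one, legendreSym_three_eq_neg_one, ha, hb] <;>
    split_ifs <;> omega

theorem three_mul_sum_Ico_of_not_dvd {d : ℕ} (hd : ¬3 ∣ d) :
    3 * ∑ l ∈ Ico 1 d, (1 - 2 * if (3 : ℤ) ∣ l then 1 else 0) = d - legendreSym 3 d := by
  have card_multiples : #{l ∈ Ico 1 d | (3 : ℤ) ∣ (l : ℕ)} = (d - 1) / 3 := by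
    exact_mod_cast Nat.Ioc_filter_dvd_card_eq_div (d - 1) 3
  simp only [sum_sub_distrib, ← mul_sum, sum_boole, card_multiples, sum_const, Nat.card_Ico,
    nsmul_eq_mul, mul_one]
  have hmod : d % 3 = 1 ∨ d % 3 = 2 := by omega
  rcases hmod with h | h
  · rw [legendreSym_three_eq_one h]
    omega
  · rw [legendreSym_three_eq_neg_one h]
    omega

theorem three_mul_sum_antidiagonal_sum_divisors_legendreSym {N : ℕ} (hN : ¬3 ∣ N) :
    3 * ∑ q ∈ antidiagonal N,
        (∑ d ∈ q.1.divisors, legendreSym 3 d) * ∑ d ∈ q.2.divisors, legendreSym 3 d =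
      sigma 1 N - ∑ d ∈ N.divisors, legendreSym 3 d := by
  have heven : (fun z : ℤ => if 3 ∣ z then (1 : ℤ) else 0).Even := fun z => by
    simp only [Int.dvd_neg]
  have liouville := liouville_identity heven N
  have hsub : ∀ f g : ℕ → ℕ → ℕ → ℕ → ℤ, quadSum N f - quadSum N g =
      quadSum N fun a x b y => f a x b y - g a x b y := fun _ _ =>
    (sum_sub_distrib _ _).symm
  simp only [hsub, ← legendreSym_three_mul_eq_ite_sub_ite] at liouville
  rw [← quadSum_mul N (fun d => legendreSym 3 d) fun d => legendreSym 3 d, liouville,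
    ArithmeticFunction.sigma_one_apply, Nat.cast_sum, ← sum_sub_distrib, mul_sum]
  refine sum_congr rfl fun d hd => ?_
  have hdvd : d ∣ N := Nat.dvd_of_mem_divisors hd
  have hd3 : ¬(3 : ℤ) ∣ d := mod_cast fun h => hN (h.trans hdvd)
  have hNd3 : ¬(3 : ℤ) ∣ (N / d : ℕ) := mod_cast fun h => hN (h.trans (Nat.div_dvd_of_dvd hdvd))
  rw [← three_mul_sum_Ico_of_not_dvd (mod_cast hd3)]
  simp only [dvd_zero, hd3, hNd3, if_true, if_false, mul_zero, add_zero, sub_zero]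

theorem three_mul_sum_antidiagonal_sum_divisors_three_mul_add_one (n : ℕ) :
    3 * ∑ q ∈ antidiagonal n, (∑ d ∈ (3 * q.1 + 1).divisors, legendreSym 3 d) *
        ∑ d ∈ (3 * q.2 + 1).divisors, legendreSym 3 d = sigma 1 (3 * n + 2) := by
  have conv := three_mul_sum_antidiagonal_sum_divisors_legendreSym
    (show ¬3 ∣ 3 * n + 2 by omega)
  rw [sum_divisors_legendreSym_three_eq_zero (show (3 * n + 2) % 3 = 2 by omega), sub_zero] at conv
  rw [← conv]
  congr 1
  refine sum_of_injOn (fun q => (3 * q.1 + 1, 3 * q.2 + 1)) ?_ ?_ ?_ fun _ _ => rfl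
  · intro q _ q' _ h
    simp only [Prod.mk.injEq] at h
    exact Prod.ext (by omega) (by omega)
  · intro q hq
    simp only [mem_coe, HasAntidiagonal.mem_antidiagonal] at hq ⊢
    omega
  · rintro ⟨i, j⟩ hij hnot
    rw [HasAntidiagonal.mem_antidiagonal] at hij
    have hmod : i % 3 = 1 ∧ j % 3 = 1 ∨ i % 3 = 2 ∨ j % 3 = 2 := by omega
    rcases hmod with ⟨hi, hj⟩ | hi | hj
    · refine absurd ⟨(i / 3, j / 3), ?_, ?_⟩ hnot
      · simp only [mem_coe, HasAntidiagonal.mem_antidiagonal]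
        omega
      · exact Prod.ext (by dsimp only; omega) (by dsimp only; omega)
    · rw [sum_divisors_legendreSym_three_eq_zero hi, zero_mul]
    · rw [sum_divisors_legendreSym_three_eq_zero hj, mul_zero]

end Liouville

section Eisenstein

open QuadraticAlgebra

/-- The Eisenstein integers `x + y ω` with `ω ^ 2 = -1 - ω`, so that the norm is
`x ^ 2 - x * y + y ^ 2`. -/
abbrev EisensteinInt : Type := QuadraticAlgebra ℤ (-1) (-1)

namespace EisensteinInt

theorem norm_eq (z : EisensteinInt) : z.norm = z.re ^ 2 - z.re * z.im + z.im ^ 2 := by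
  rw [norm_def]
  ring

theorem sq_re_le (z : EisensteinInt) : z.re ^ 2 ≤ 2 * z.norm := by
  rw [norm_eq]
  linarith [sq_nonneg (z.re - z.im), sq_nonneg z.im]

theorem sq_im_le (z : EisensteinInt) : z.im ^ 2 ≤ 2 * z.norm := by
  rw [norm_eq]
  linarith [sq_nonneg (z.re - z.im), sq_nonneg z.re]

theorem norm_nonneg (z : EisensteinInt) : 0 ≤ z.norm := by
  linarith [sq_re_le z, sq_nonneg z.re]

theorem norm_eq_zero_iff {z : EisensteinInt} : z.norm = 0 ↔ z = 0 := by
  refine ⟨fun h => QuadraticAlgebra.ext ?_ ?_, fun h => h ▸ norm_zero⟩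
  · exact pow_eq_zero_iff two_ne_zero |>.1 (le_antisymm (by linarith [sq_re_le z]) (sq_nonneg _))
  · exact pow_eq_zero_iff two_ne_zero |>.1 (le_antisymm (by linarith [sq_im_le z]) (sq_nonneg _))

theorem norm_pos {z : EisensteinInt} (hz : z ≠ 0) : 0 < z.norm :=
  (norm_nonneg z).lt_of_ne' (mt norm_eq_zero_iff.1 hz)

theorem isUnit_iff_natAbs_norm_eq_one {z : EisensteinInt} : IsUnit z ↔ z.norm.natAbs = 1 := by
  rw [isUnit_iff_norm_isUnit, Int.isUnit_iff_natAbs_eq]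

/-- Division with remainder: the coordinates of the exact quotient `x * star y / norm y` are
rounded to nearest integers. -/
instance : Div EisensteinInt where
  div x y := ⟨(x * star y).re.bdiv y.norm.natAbs, (x * star y).im.bdiv y.norm.natAbs⟩

theorem div_def (x y : EisensteinInt) :
    x / y = ⟨(x * star y).re.bdiv y.norm.natAbs, (x * star y).im.bdiv y.norm.natAbs⟩ := rfl

theorem sub_mul_div_mul_star (x y : EisensteinInt) :
    (x - y * (x / y)) * star y =
      ⟨(x * star y).re.bmod y.norm.natAbs, (x * star y).im.bmod y.norm.natAbs⟩ := by
  have hnorm : y * star y = (y.norm.natAbs : ℤ) := by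
    rw [Int.natAbs_of_nonneg (norm_nonneg y), ← algebraMap_norm_eq_mul_star]
    rfl
  rw [show (x - y * (x / y)) * star y = x * star y - y * star y * (x / y) by ring, hnorm, div_def,
    Int.bmod_eq_self_sub_mul_bdiv, Int.bmod_eq_self_sub_mul_bdiv]
  ext <;> simp only [re_sub, im_sub, re_mul, im_mul, re_intCast, im_intCast, Int.cast_id] <;>
    ring

theorem norm_sub_mul_div_lt (x : EisensteinInt) {y : EisensteinInt} (hy : y ≠ 0) :
    (x - y * (x / y)).norm < y.norm := by
  have hpos : 0 < y.norm.natAbs := Int.natAbs_pos.2 (norm_pos hy).ne'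
  have hnorm : (y.norm.natAbs : ℤ) = y.norm := Int.natAbs_of_nonneg (norm_nonneg y)
  have hbound : ∀ u : ℤ, (2 * u.bmod y.norm.natAbs) ^ 2 ≤ y.norm ^ 2 := fun u => by
    have := Int.le_bmod (x := u) hpos
    have := Int.bmod_le (x := u) hpos
    exact sq_le_sq' (by omega) (by omega)
  refine lt_of_mul_lt_mul_right ?_ (norm_nonneg y)
  calc (x - y * (x / y)).norm * y.norm = ((x - y * (x / y)) * star y).norm := by
        rw [map_mul, QuadraticAlgebra.norm_star]
    _ < y.norm * y.norm := by
        rw [sub_mul_div_mul_star, norm_eq]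
        have := hbound (x * star y).re
        have := hbound (x * star y).im
        nlinarith [sq_nonneg ((x * star y).re.bmod y.norm.natAbs +
          (x * star y).im.bmod y.norm.natAbs), norm_pos hy]

instance : EuclideanDomain EisensteinInt where
  quotient := (· / ·)
  remainder x y := x - y * (x / y)
  quotient_zero x := by
    rw [div_def, star_zero, mul_zero]
    rfl
  quotient_mul_add_remainder_eq x y := add_sub_cancel (y * (x / y)) x
  r x y := x.norm.natAbs < y.norm.natAbs
  r_wellFounded := (measure fun x : EisensteinInt => x.norm.natAbs).wf
  remainder_lt x y hy :=
    Int.natAbs_lt_natAbs_of_nonneg_of_lt (norm_nonneg _) (norm_sub_mul_div_lt x hy)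
  mul_left_not_lt x y hy := by
    rw [map_mul, Int.natAbs_mul, not_lt]
    exact Nat.le_mul_of_pos_right _ (Int.natAbs_pos.2 (norm_pos hy).ne')

theorem norm_dvd_norm_of_dvd {w z : EisensteinInt} (h : w ∣ z) : w.norm ∣ z.norm :=
  map_dvd QuadraticAlgebra.norm h

theorem natCast_dvd_iff {p : ℕ} {z : EisensteinInt} :
    (p : EisensteinInt) ∣ z ↔ (p : ℤ) ∣ z.re ∧ (p : ℤ) ∣ z.im :=
  algebraMap_dvd_iff (r := (p : ℤ))

theorem dvd_of_prime_of_dvd_norm {p : ℕ} (hp : Prime (p : EisensteinInt)) {z : EisensteinInt}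
    (h : (p : ℤ) ∣ z.norm) : (p : EisensteinInt) ∣ z := by
  have hdvd : (p : EisensteinInt) ∣ z * star z := by
    rw [← algebraMap_norm_eq_mul_star]
    exact_mod_cast map_dvd (algebraMap ℤ EisensteinInt) h
  refine (hp.dvd_or_dvd hdvd).elim id fun hstar => ?_
  simpa only [starRingEnd_apply, star_natCast, star_star] using
    map_dvd (starRingEnd EisensteinInt) hstar

theorem exists_norm_eq_of_not_prime {p : ℕ} (hp : p.Prime) (h : ¬Prime (p : EisensteinInt)) :
    ∃ z : EisensteinInt, z.norm = p := by
  have not_isUnit : ¬IsUnit (p : EisensteinInt) := by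
    rw [isUnit_iff_natAbs_norm_eq_one, QuadraticAlgebra.norm_natCast, ← Nat.cast_pow,
      Int.natAbs_natCast]
    exact (Nat.one_lt_pow two_ne_zero hp.one_lt).ne'
  rw [← irreducible_iff_prime, irreducible_iff] at h
  push Not at h
  obtain ⟨z, w, hzw, hz, hw⟩ := h not_isUnit
  rw [isUnit_iff_natAbs_norm_eq_one] at hz hw
  have hnorm : z.norm.natAbs * w.norm.natAbs = p ^ 2 := by
    rw [← Int.natAbs_mul, ← map_mul, ← hzw, QuadraticAlgebra.norm_natCast, ← Nat.cast_pow,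
      Int.natAbs_natCast]
  have hp_eq : z.norm.natAbs = p := ((hp.mul_eq_prime_sq_iff hz hw).1 hnorm).1
  exact ⟨z, by rw [← hp_eq, Int.natAbs_of_nonneg (norm_nonneg z)]⟩

theorem norm_emod_three_ne_two (z : EisensteinInt) : z.norm % 3 ≠ 2 := by
  have hnorm : z.norm = (z.re + z.im) ^ 2 - 3 * (z.re * z.im) := by
    rw [norm_eq]
    ring
  have hmod : (z.re + z.im) % 3 = 0 ∨ (z.re + z.im) % 3 = 1 ∨ (z.re + z.im) % 3 = 2 := by omega
  have hsq : (z.re + z.im) ^ 2 % 3 = 0 ∨ (z.re + z.im) ^ 2 % 3 = 1 := by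
    rcases hmod with h | h | h <;> simp [pow_two, Int.mul_emod, h]
  omega

theorem prime_natCast {p : ℕ} (hp : p.Prime) (hp3 : p % 3 = 2) : Prime (p : EisensteinInt) := by
  by_contra h
  obtain ⟨z, hz⟩ := exists_norm_eq_of_not_prime hp h
  exact norm_emod_three_ne_two z (by omega)

theorem prime_of_prime_norm {z : EisensteinInt} (hz : Prime z.norm) : Prime z := by
  have : IsLocalHom (QuadraticAlgebra.norm : EisensteinInt →* ℤ) :=
    ⟨fun _ => isUnit_iff_norm_isUnit.2⟩
  exact (hz.irreducible.of_map (f := QuadraticAlgebra.norm)).prime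

theorem exists_prime_dvd_sq_add_add_one {p : ℕ} (hp : p.Prime) (hp3 : p % 3 = 1) :
    ∃ c : ℤ, (p : ℤ) ∣ c ^ 2 + c + 1 := by
  have : Fact p.Prime := ⟨hp⟩
  have hcard : 3 ∣ Nat.card (ZMod p)ˣ := by
    rw [Nat.card_eq_fintype_card, ZMod.card_units]
    omega
  obtain ⟨u, hu⟩ := exists_prime_orderOf_dvd_card' 3 hcard
  have hu1 : (u : ZMod p) - 1 ≠ 0 := sub_ne_zero.2 fun h => by
    rw [Units.val_eq_one.1 h, orderOf_one] at hu
    exact absurd hu (by norm_num)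
  have hu3 : (u : ZMod p) ^ 3 = 1 := by
    rw [← hu, ← Units.val_pow_eq_pow_val, pow_orderOf_eq_one, Units.val_one]
  obtain ⟨c, hc⟩ := ZMod.intCast_surjective (u : ZMod p)
  refine ⟨c, (ZMod.intCast_zmod_eq_zero_iff_dvd _ p).1 (mul_left_cancel₀ hu1 ?_)⟩
  push_cast
  rw [hc]
  linear_combination hu3

theorem exists_norm_eq {p : ℕ} (hp : p.Prime) (hp3 : p % 3 = 1) :
    ∃ z : EisensteinInt, z.norm = p := by
  refine exists_norm_eq_of_not_prime hp fun hprime => ?_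
  obtain ⟨c, hc⟩ := exists_prime_dvd_sq_add_add_one hp hp3
  have hdvd : (p : EisensteinInt) ∣ ⟨c, -1⟩ := dvd_of_prime_of_dvd_norm hprime (by
    rw [norm_eq]
    ring_nf at hc ⊢
    exact hc)
  have hneg_one : (p : ℤ) ∣ -1 := (natCast_dvd_iff.1 hdvd).2
  exact hp.one_lt.ne' (Nat.dvd_one.1 (by exact_mod_cast (Int.dvd_neg.1 hneg_one)))

theorem not_dvd_star {p : ℕ} (hp : p.Prime) (hp3 : p ≠ 3) {z : EisensteinInt} (hz : z.norm = p) :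
    ¬z ∣ star z := by
  intro h
  have hpZ : Prime (p : ℤ) := Nat.prime_iff_prime_int.1 hp
  have hnorm : (z - star z).norm = 3 * z.im ^ 2 := by
    rw [norm_eq]
    simp only [re_sub, im_sub, re_star, im_star]
    ring
  have hdvd : (p : ℤ) ∣ 3 * z.im ^ 2 := by
    rw [← hnorm, ← hz]
    exact norm_dvd_norm_of_dvd (dvd_sub_self_left.2 h)
  have him : (p : ℤ) ∣ z.im := by
    refine hpZ.dvd_of_dvd_pow ((hpZ.dvd_or_dvd hdvd).resolve_left fun h3 => hp3 ?_)
    exact (Nat.prime_dvd_prime_iff_eq hp Nat.prime_three).1 (by exact_mod_cast h3)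
  have hre : (p : ℤ) ∣ z.re := by
    refine hpZ.dvd_of_dvd_pow (n := 2) ?_
    rw [show z.re ^ 2 = p + z.im * (z.re - z.im) by rw [← hz, norm_eq]; ring]
    exact dvd_add dvd_rfl (him.mul_right _)
  have hsq := norm_dvd_norm_of_dvd (natCast_dvd_iff.2 ⟨hre, him⟩)
  rw [QuadraticAlgebra.norm_natCast, hz] at hsq
  exact (Nat.le_of_dvd hp.pos (by exact_mod_cast hsq)).not_gt
    (lt_self_pow₀ hp.one_lt one_lt_two)

theorem mul_star_eq_natCast {n : ℕ} {z : EisensteinInt} (hz : z.norm = n) :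
    z * star z = (n : EisensteinInt) := by
  rw [← algebraMap_norm_eq_mul_star, hz, map_natCast]

theorem dvd_or_star_dvd {p : ℕ} (hp : p.Prime) {w z : EisensteinInt} (hw : w.norm = p)
    (h : (p : ℤ) ∣ z.norm) : w ∣ z ∨ star w ∣ z := by
  have hprime : Prime w := prime_of_prime_norm (hw ▸ Nat.prime_iff_prime_int.1 hp)
  have hdvd : w ∣ z * star z := by
    rw [← algebraMap_norm_eq_mul_star]
    refine (Dvd.intro (star w) (mul_star_eq_natCast hw)).trans ?_
    exact_mod_cast map_dvd (algebraMap ℤ EisensteinInt) h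
  refine (hprime.dvd_or_dvd hdvd).imp_right fun hstar => ?_
  simpa only [starRingEnd_apply, star_star] using map_dvd (starRingEnd EisensteinInt) hstar

theorem dvd_and_star_dvd_iff {p : ℕ} (hp : p.Prime) (hp3 : p ≠ 3) {w z : EisensteinInt}
    (hw : w.norm = p) : w ∣ z ∧ star w ∣ z ↔ (p : EisensteinInt) ∣ z := by
  rw [← mul_star_eq_natCast hw]
  refine ⟨?_, fun h => ⟨dvd_of_mul_right_dvd h, dvd_of_mul_left_dvd h⟩⟩
  rintro ⟨⟨t, rfl⟩, h⟩
  have hw_star : (star w).norm = p := by rw [QuadraticAlgebra.norm_star, hw]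
  have hprime : Prime (star w) := prime_of_prime_norm (hw_star ▸ Nat.prime_iff_prime_int.1 hp)
  have hnot := not_dvd_star hp hp3 hw_star
  rw [star_star] at hnot
  exact mul_dvd_mul_left w ((hprime.dvd_or_dvd h).resolve_left hnot)

/-- The number of Eisenstein integers of norm `n`. -/
noncomputable def normCount (n : ℕ) : ℕ := {z : EisensteinInt | z.norm = n}.ncard

/-- The number of multiples of `w` of norm `n` among the Eisenstein integers. -/
noncomputable def normDvdCount (w : EisensteinInt) (n : ℕ) : ℕ :=
  {z : EisensteinInt | z.norm = n ∧ w ∣ z}.ncard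

theorem mem_Icc_of_norm_eq {n : ℕ} {z : EisensteinInt} (hz : z.norm = n) :
    z.re ∈ Set.Icc (-(2 * n : ℤ)) (2 * n) ∧ z.im ∈ Set.Icc (-(2 * n : ℤ)) (2 * n) := by
  have hbound : ∀ u : ℤ, u ^ 2 ≤ 2 * n → u ∈ Set.Icc (-(2 * n : ℤ)) (2 * n) := fun u hu =>
    abs_le.1 ((Int.le_self_sq |u|).trans (by rwa [sq_abs]))
  exact ⟨hbound _ (hz ▸ sq_re_le z), hbound _ (hz ▸ sq_im_le z)⟩

theorem finite_norm_eq (n : ℕ) : {z : EisensteinInt | z.norm = n}.Finite :=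
  (((Set.finite_Icc _ _).prod (Set.finite_Icc _ _)).preimage
    (equivProd _ _).injective.injOn).subset fun _ hz => mem_Icc_of_norm_eq hz

theorem normDvdCount_mul {m : ℕ} (hm : m ≠ 0) {w : EisensteinInt} (hw : w.norm = m) (M : ℕ) :
    normDvdCount w (m * M) = normCount M := by
  have hw0 : w ≠ 0 := by
    rintro rfl
    exact hm (by exact_mod_cast hw.symm.trans QuadraticAlgebra.norm_zero)
  rw [normCount, ← Set.ncard_image_of_injective _ (mul_right_injective₀ hw0), normDvdCount]
  congr 1
  ext z
  constructor
  · rintro ⟨hz, t, rfl⟩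
    rw [map_mul, hw, Nat.cast_mul] at hz
    exact ⟨t, mul_left_cancel₀ (by exact_mod_cast hm) hz, rfl⟩
  · rintro ⟨t, ht, rfl⟩
    rw [Set.mem_ofPred_eq] at ht
    exact ⟨by rw [map_mul, hw, ht, Nat.cast_mul], dvd_mul_right w t⟩

theorem normDvdCount_prime_mul_prime_mul {p : ℕ} (hp : p.Prime) (M : ℕ) :
    normDvdCount p (p * (p * M)) = normCount M := by
  rw [← mul_assoc]
  refine normDvdCount_mul (mul_ne_zero hp.ne_zero hp.ne_zero) ?_ M
  rw [QuadraticAlgebra.norm_natCast, pow_two, Nat.cast_mul]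

theorem normDvdCount_prime_mul_of_not_dvd {p : ℕ} (hp : p.Prime) {M : ℕ} (hM : ¬p ∣ M) :
    normDvdCount p (p * M) = 0 := by
  rw [normDvdCount, Set.ncard_eq_zero ((finite_norm_eq _).subset fun _ hz => hz.1)]
  refine Set.eq_empty_of_forall_notMem fun z ⟨hz, hdvd⟩ => hM ?_
  have hsq := norm_dvd_norm_of_dvd hdvd
  rw [QuadraticAlgebra.norm_natCast, hz, pow_two] at hsq
  exact Nat.dvd_of_mul_dvd_mul_left hp.pos (by exact_mod_cast hsq)

theorem normCount_prime_mul_add {p : ℕ} (hp : p.Prime) (hp3 : p % 3 = 1) (M : ℕ) :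
    normCount (p * M) + normDvdCount p (p * M) = 2 * normCount M := by
  obtain ⟨w, hw⟩ := exists_norm_eq hp hp3
  have hw_star : (star w).norm = p := by rw [QuadraticAlgebra.norm_star, hw]
  have hunion : {z : EisensteinInt | z.norm = (p * M : ℕ)} =
      {z : EisensteinInt | z.norm = (p * M : ℕ) ∧ w ∣ z} ∪
        {z : EisensteinInt | z.norm = (p * M : ℕ) ∧ star w ∣ z} := by
    ext z
    simp only [Set.mem_union, Set.mem_ofPred_eq, ← and_or_left, iff_self_and]
    exact fun hz => dvd_or_star_dvd hp hw (hz ▸ by simp)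
  have hinter : {z : EisensteinInt | z.norm = (p * M : ℕ) ∧ (p : EisensteinInt) ∣ z} =
      {z : EisensteinInt | z.norm = (p * M : ℕ) ∧ w ∣ z} ∩
        {z : EisensteinInt | z.norm = (p * M : ℕ) ∧ star w ∣ z} := by
    ext z
    simp only [Set.mem_inter_iff, Set.mem_ofPred_eq, ← dvd_and_star_dvd_iff hp (by omega) hw]
    tauto
  have hfin := finite_norm_eq (p * M)
  rw [normCount, normDvdCount, hunion, hinter, Set.ncard_union_add_ncard_inter _ _
    (hfin.subset fun _ hz => hz.1) (hfin.subset fun _ hz => hz.1), ← normDvdCount, ← normDvdCount,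
    normDvdCount_mul hp.ne_zero hw, normDvdCount_mul hp.ne_zero hw_star, two_mul]

theorem normCount_prime_mul_of_mod_two {p : ℕ} (hp : p.Prime) (hp3 : p % 3 = 2) (M : ℕ) :
    normCount (p * M) = normDvdCount p (p * M) := by
  rw [normCount, normDvdCount]
  congr 1
  ext z
  simp only [Set.mem_ofPred_eq, iff_self_and]
  exact fun hz => dvd_of_prime_of_dvd_norm (prime_natCast hp hp3) (hz ▸ by simp)

theorem normCount_prime_mul {p : ℕ} (hp : p.Prime) (hp3 : p ≠ 3) (M : ℕ) :
    (normCount (p * M) : ℤ) =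
      (1 + legendreSym 3 p) * normCount M - legendreSym 3 p * normDvdCount p (p * M) := by
  have hmod : p % 3 = 1 ∨ p % 3 = 2 := by
    have := mt (Nat.prime_dvd_prime_iff_eq Nat.prime_three hp).1 hp3.symm
    omega
  rcases hmod with h | h
  · have hadd := normCount_prime_mul_add hp h M
    rw [legendreSym_three_eq_one h]
    zify at hadd
    linarith
  · rw [legendreSym_three_eq_neg_one h, normCount_prime_mul_of_mod_two hp h]
    ring

theorem normCount_one : normCount 1 = 6 := by
  have units : {z : EisensteinInt | z.norm = (1 : ℕ)} =
      ({⟨1, 0⟩, ⟨-1, 0⟩, ⟨0, 1⟩, ⟨0, -1⟩, ⟨1, 1⟩, ⟨-1, -1⟩} : Finset EisensteinInt) := by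
    ext z
    rw [Set.mem_ofPred_eq, mem_coe]
    constructor
    · intro hz
      obtain ⟨⟨hx, hx'⟩, hy, hy'⟩ := mem_Icc_of_norm_eq hz
      obtain ⟨x, y⟩ := z
      rw [norm_eq] at hz
      simp only at hx hx' hy hy' hz
      push_cast at *
      interval_cases x <;> interval_cases y <;> first | decide | omega
    · revert z
      decide
  rw [normCount, units, Set.ncard_coe_finset]
  decide

theorem normCount_eq_six_mul_sum_divisors {n : ℕ} (hn : ¬3 ∣ n) :
    (normCount n : ℤ) = 6 * ∑ d ∈ n.divisors, legendreSym 3 d := by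
  have hmul : ∀ a b : ℕ, legendreSym 3 (a * b : ℕ) = legendreSym 3 a * legendreSym 3 b :=
    fun a b => by rw [Nat.cast_mul, legendreSym.mul]
  induction n using Nat.strong_induction_on with
  | _ n ih =>
    obtain rfl | hn1 := eq_or_ne n 1
    · simp [normCount_one]
    obtain ⟨M, hM⟩ := Nat.minFac_dvd n
    have hp := Nat.minFac_prime hn1
    generalize n.minFac = p at hM hp
    subst hM
    have hp3 : p ≠ 3 := fun h => hn (h ▸ dvd_mul_right p M)
    have hM3 : ¬3 ∣ M := fun h => hn (h.mul_left p)
    have lt_mul : ∀ {L}, ¬3 ∣ L → L < p * L := fun {L} hL =>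
      lt_mul_left (Nat.pos_of_ne_zero fun h => hL (h ▸ dvd_zero 3)) hp.one_lt
    rw [normCount_prime_mul hp hp3, ih M (lt_mul hM3) hM3]
    by_cases hpM : p ∣ M
    · obtain ⟨L, rfl⟩ := hpM
      have hL3 : ¬3 ∣ L := fun h => hM3 (h.mul_left p)
      have hrec := sum_divisors_prime_mul_prime_mul (h := fun d => legendreSym 3 d) (M := L) hmul hp
      rw [normDvdCount_prime_mul_prime_mul hp, ih L ((lt_mul hL3).trans (lt_mul hM3)) hL3]
      linear_combination -6 * hrec
    · rw [normDvdCount_prime_mul_of_not_dvd hp hpM, sum_divisors_prime_mul_of_not_dvd hmul hp hpM]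
      push_cast
      ring

end EisensteinInt

end Eisenstein

section Quadrant

/-- The integral solutions of `a ^ 2 - a * b + b ^ 2 + b = n`. They are in bijection with the
Eisenstein integers of norm `3 * n + 1` that are `1` modulo the prime above `3`, and those in the
quadrant `0 ≤ a`, `0 ≤ b` with the `3`-cores of size `n`. -/
def coreCoordinates (n : ℕ) : Set (ℤ × ℤ) := {q | q.1 ^ 2 - q.1 * q.2 + q.2 ^ 2 + q.2 = n}

/-- The order three symmetry of `coreCoordinates n` that corresponds to the multiplication by a cube
root of unity. -/
def coreRotation : ℤ × ℤ ≃ ℤ × ℤ where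
  toFun q := (q.2 - q.1, -q.1 - 1)
  invFun q := (-q.2 - 1, q.1 - q.2 - 1)
  left_inv q := by ext <;> dsimp only <;> ring
  right_inv q := by ext <;> dsimp only <;> ring

theorem coreRotation_mem_iff {n : ℕ} {q : ℤ × ℤ} :
    coreRotation q ∈ coreCoordinates n ↔ q ∈ coreCoordinates n := by
  simp only [coreCoordinates, coreRotation, Equiv.coe_fn_mk, Set.mem_ofPred_eq]
  ring_nf

theorem ncard_coreCoordinates_and_coreRotation (n : ℕ) (P : ℤ × ℤ → Prop) :
    {q ∈ coreCoordinates n | P (coreRotation q)}.ncard = {q ∈ coreCoordinates n | P q}.ncard := by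
  rw [← Set.ncard_image_of_injective _ coreRotation.injective,
    coreRotation.image_eq_preimage_symm]
  congr 1
  ext q
  simp only [Set.mem_preimage, Set.mem_ofPred_eq, Equiv.apply_symm_apply,
    ← coreRotation_mem_iff (q := coreRotation.symm q)]

namespace EisensteinInt

open QuadraticAlgebra

theorem bijOn_coreCoordinates (n : ℕ) :
    Set.BijOn (fun q : ℤ × ℤ => (⟨1 + q.1 + q.2, 2 * q.1 - q.2⟩ : EisensteinInt))
      (coreCoordinates n) {z | z.norm = (3 * n + 1 : ℕ) ∧ (z.re + z.im) % 3 = 1} := by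
  refine ⟨?_, ?_, ?_⟩
  · rintro ⟨a, b⟩ hq
    simp only [coreCoordinates, Set.mem_ofPred_eq, norm_eq] at hq ⊢
    push_cast
    exact ⟨by linear_combination 3 * hq, by omega⟩
  · rintro ⟨a, b⟩ - ⟨a', b'⟩ - h
    simp only [QuadraticAlgebra.mk.injEq] at h
    exact Prod.ext (by dsimp only; omega) (by dsimp only; omega)
  · rintro ⟨x, y⟩ ⟨hz, hmod⟩
    obtain ⟨a, ha⟩ : ∃ a, x + y = 3 * a + 1 := ⟨(x + y) / 3, by dsimp only at hmod; omega⟩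
    obtain rfl : y = 3 * a + 1 - x := by omega
    refine ⟨(a, x - 1 - a), ?_, QuadraticAlgebra.ext (by dsimp only; ring) (by dsimp only; ring)⟩
    simp only [coreCoordinates, Set.mem_ofPred_eq, norm_eq] at hz ⊢
    push_cast at hz
    linarith

theorem finite_coreCoordinates (n : ℕ) : (coreCoordinates n).Finite :=
  (bijOn_coreCoordinates n).finite_iff_finite.2 ((finite_norm_eq _).subset fun _ hz => hz.1)

theorem normCount_three_mul_add_one (n : ℕ) :
    normCount (3 * n + 1) = 2 * (coreCoordinates n).ncard := by
  have hsplit : {z : EisensteinInt | z.norm = (3 * n + 1 : ℕ)} =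
      {z : EisensteinInt | z.norm = (3 * n + 1 : ℕ) ∧ (z.re + z.im) % 3 = 1} ∪
        {z : EisensteinInt | z.norm = (3 * n + 1 : ℕ) ∧ (z.re + z.im) % 3 = 2} := by
    ext z
    simp only [Set.mem_union, Set.mem_ofPred_eq, ← and_or_left, iff_self_and]
    intro hz
    by_contra hmod
    obtain ⟨a, ha⟩ : ∃ a, z.re + z.im = 3 * a := ⟨(z.re + z.im) / 3, by omega⟩
    have h3 : 3 * (3 * a ^ 2 - z.re * z.im) = 3 * n + 1 := by
      rw [norm_eq] at hz
      push_cast at hz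
      linear_combination hz - (z.re + z.im + 3 * a) * ha
    omega
  have hneg : {z : EisensteinInt | z.norm = (3 * n + 1 : ℕ) ∧ (z.re + z.im) % 3 = 2}.ncard =
      {z : EisensteinInt | z.norm = (3 * n + 1 : ℕ) ∧ (z.re + z.im) % 3 = 1}.ncard := by
    rw [← Set.ncard_image_of_injective _ neg_injective, Set.image_neg_eq_neg]
    congr 1
    ext z
    simp only [Set.mem_neg, Set.mem_ofPred_eq, norm_eq, re_neg, im_neg,
      neg_sq, neg_mul_neg]
    refine and_congr_right fun _ => ?_
    omega
  rw [normCount, hsplit, Set.ncard_union_eq _ ((finite_norm_eq _).subset fun _ hz => hz.1)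
    ((finite_norm_eq _).subset fun _ hz => hz.1), hneg,
    ← (bijOn_coreCoordinates n).ncard_eq, two_mul]
  refine Set.disjoint_left.2 fun z hz hz' => ?_
  have := hz.2.symm.trans hz'.2
  omega

end EisensteinInt

theorem ncard_coreCoordinates (n : ℕ) :
    (coreCoordinates n).ncard = 3 * {q ∈ coreCoordinates n | 0 ≤ q.1 ∧ 0 ≤ q.2}.ncard := by
  have hfin : ∀ P : ℤ × ℤ → Prop, {q ∈ coreCoordinates n | P q}.Finite := fun _ =>
    (EisensteinInt.finite_coreCoordinates n).subset fun _ hq => hq.1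
  let P : ℤ × ℤ → Prop := fun q => 0 ≤ q.1 ∧ 0 ≤ q.2
  have hrot := ncard_coreCoordinates_and_coreRotation n P
  have hrot_rot := ncard_coreCoordinates_and_coreRotation n fun q => P (coreRotation q)
  have hunion : coreCoordinates n = {q ∈ coreCoordinates n | P q} ∪
      ({q ∈ coreCoordinates n | P (coreRotation q)} ∪
        {q ∈ coreCoordinates n | P (coreRotation (coreRotation q))}) := by
    ext q
    simp only [Set.mem_union, Set.mem_ofPred_eq, ← and_or_left, iff_self_and, P, coreRotation,
      Equiv.coe_fn_mk]
    omega
  have hdisj : Disjoint {q ∈ coreCoordinates n | P (coreRotation q)}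
      {q ∈ coreCoordinates n | P (coreRotation (coreRotation q))} := by
    refine Set.disjoint_left.2 fun q hq hq' => ?_
    simp only [Set.mem_ofPred_eq, P, coreRotation, Equiv.coe_fn_mk] at hq hq'
    omega
  have hdisj' : Disjoint {q ∈ coreCoordinates n | P q}
      ({q ∈ coreCoordinates n | P (coreRotation q)} ∪
        {q ∈ coreCoordinates n | P (coreRotation (coreRotation q))}) := by
    refine Set.disjoint_left.2 fun q hq hq' => ?_
    simp only [Set.mem_union, Set.mem_ofPred_eq, P, coreRotation, Equiv.coe_fn_mk] at hq hq'
    omega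
  have hcard := congrArg Set.ncard hunion
  rw [Set.ncard_union_eq hdisj' (hfin _) ((hfin _).union (hfin _)),
    Set.ncard_union_eq hdisj (hfin _) (hfin _), hrot_rot, hrot] at hcard
  rw [hcard]
  ring

theorem bijOn_natCast_coreCoordinates (n : ℕ) :
    Set.BijOn (Prod.map Nat.cast Nat.cast) {q : ℕ × ℕ | q.1 ^ 2 + q.2 ^ 2 + q.2 = n + q.1 * q.2}
      {q ∈ coreCoordinates n | 0 ≤ q.1 ∧ 0 ≤ q.2} := by
  have hiff : ∀ a b : ℕ, a ^ 2 + b ^ 2 + b = n + a * b ↔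
      ((a, b) : ℤ × ℤ) ∈ coreCoordinates n := fun a b => by
    rw [coreCoordinates, Set.mem_ofPred_eq]
    zify
    constructor <;> intro h <;> linear_combination h
  refine ⟨fun q hq => ⟨(hiff _ _).1 hq, by simp⟩,
    (Nat.cast_injective.prodMap Nat.cast_injective).injOn, ?_⟩
  rintro ⟨a, b⟩ ⟨hq, ha, hb⟩
  lift a to ℕ using ha
  lift b to ℕ using hb
  exact ⟨(a, b), (hiff a b).2 hq, rfl⟩

theorem ncard_nat_coreCoordinates (n : ℕ) :
    ({q : ℕ × ℕ | q.1 ^ 2 + q.2 ^ 2 + q.2 = n + q.1 * q.2}.ncard : ℤ) =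
      ∑ d ∈ (3 * n + 1).divisors, legendreSym 3 d := by
  have hcount := EisensteinInt.normCount_eq_six_mul_sum_divisors (show ¬3 ∣ 3 * n + 1 by omega)
  rw [EisensteinInt.normCount_three_mul_add_one, ncard_coreCoordinates,
    ← (bijOn_natCast_coreCoordinates n).ncard_eq] at hcount
  push_cast at hcount
  linarith

end Quadrant

section BetaSets

variable {μ ν : YoungDiagram} {i j : ℕ}

/-- The set of first-column hook lengths of `μ`. It determines `μ`, and hook lengths of `μ` are
differences between an element and a smaller non-element of it. -/
def betaSet (μ : YoungDiagram) : Finset ℕ := (range (μ.colLen 0)).image (μ.hookLength · 0)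

theorem mem_betaSet {x : ℕ} : x ∈ betaSet μ ↔ ∃ i < μ.colLen 0, μ.hookLength i 0 = x := by
  simp only [betaSet, mem_image, mem_range]

theorem lt_rowLen_iff_lt_colLen : j < μ.rowLen i ↔ i < μ.colLen j :=
  mem_iff_lt_rowLen.symm.trans mem_iff_lt_colLen

theorem hookLength_zero_add (hi : i < μ.colLen 0) :
    μ.hookLength i 0 + (i + 1) = μ.rowLen i + μ.colLen 0 := by
  have := lt_rowLen_iff_lt_colLen.2 hi
  unfold hookLength
  omega

theorem strictAntiOn_hookLength_zero (μ : YoungDiagram) :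
    StrictAntiOn (μ.hookLength · 0) (Set.Iio (μ.colLen 0)) := by
  intro i hi k hk hik
  have hooki := hookLength_zero_add hi
  have hookk := hookLength_zero_add hk
  have := μ.rowLen_anti i k hik.le
  dsimp only
  omega

theorem injOn_hookLength_zero (μ : YoungDiagram) :
    Set.InjOn (μ.hookLength · 0) (range (μ.colLen 0)) := by
  simpa only [coe_range] using (strictAntiOn_hookLength_zero μ).injOn

theorem zero_notMem_betaSet (μ : YoungDiagram) : 0 ∉ betaSet μ := by
  simp [mem_betaSet, hookLength]

theorem card_betaSet (μ : YoungDiagram) : #(betaSet μ) = μ.colLen 0 := by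
  rw [betaSet, card_image_of_injOn (injOn_hookLength_zero μ), card_range]

theorem card_eq_sum_rowLen (μ : YoungDiagram) :
    μ.card = ∑ i ∈ range (μ.colLen 0), μ.rowLen i := by
  have hfst : ∀ c ∈ μ.cells, c.1 ∈ range (μ.colLen 0) := fun c hc =>
    mem_range.2 (mem_iff_lt_colLen.1 (μ.up_left_mem le_rfl (Nat.zero_le c.2) hc))
  rw [YoungDiagram.card, card_eq_sum_card_fiberwise hfst]
  exact sum_congr rfl fun i _ => (μ.rowLen_eq_card).symm

theorem sum_betaSet (μ : YoungDiagram) :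
    ∑ x ∈ betaSet μ, x = μ.card + ∑ i ∈ range (μ.colLen 0), i := by
  rw [betaSet, sum_image (injOn_hookLength_zero μ), card_eq_sum_rowLen,
    ← sum_range_reflect (fun i => i), ← sum_add_distrib]
  refine sum_congr rfl fun i hi => ?_
  have := hookLength_zero_add (mem_range.1 hi)
  have := mem_range.1 hi
  omega

theorem colLen_zero_eq_of_betaSet_eq (h : betaSet μ = betaSet ν) :
    μ.colLen 0 = ν.colLen 0 := by
  rw [← card_betaSet, h, card_betaSet]

theorem hookLength_zero_eq_of_betaSet_eq (h : betaSet μ = betaSet ν) (hi : i < ν.colLen 0) :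
    μ.hookLength i 0 = ν.hookLength i 0 := by
  have hcol := colLen_zero_eq_of_betaSet_eq h
  have anti (ξ : YoungDiagram) (hξ : ξ.colLen 0 = ν.colLen 0) :
      StrictAnti fun a : Fin (ν.colLen 0) => ξ.hookLength a 0 := fun a b hab =>
    strictAntiOn_hookLength_zero ξ (a.2.trans_eq hξ.symm) (b.2.trans_eq hξ.symm) hab
  have range_eq (ξ : YoungDiagram) (hξ : ξ.colLen 0 = ν.colLen 0) :
      (Set.range fun a : Fin (ν.colLen 0) => ξ.hookLength a 0) = betaSet ξ := by
    ext x
    simp [mem_betaSet, hξ, Fin.exists_iff]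
  have hfun := ((anti μ hcol).range_inj (anti ν rfl)).1 (by rw [range_eq μ hcol, range_eq ν rfl, h])
  exact congrFun hfun ⟨i, hi⟩

theorem betaSet_injective : Function.Injective betaSet := by
  intro μ ν h
  have hcol := colLen_zero_eq_of_betaSet_eq h
  have hrow (i : ℕ) : μ.rowLen i = ν.rowLen i := by
    by_cases hi : i < ν.colLen 0
    · have hμ := hookLength_zero_add (hi.trans_eq hcol.symm)
      have hν := hookLength_zero_add hi
      have := hookLength_zero_eq_of_betaSet_eq h hi
      omega
    · have hμ := (lt_rowLen_iff_lt_colLen (μ := μ) (i := i) (j := 0)).not.2 (hcol ▸ hi)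
      have hν := (lt_rowLen_iff_lt_colLen (μ := ν) (i := i) (j := 0)).not.2 hi
      omega
  ext ⟨i, j⟩
  rw [mem_cells, mem_cells, mem_iff_lt_rowLen, mem_iff_lt_rowLen, hrow]

theorem monotone_sub_val_of_strictMono {k : ℕ} {e : Fin k → ℕ} (he : StrictMono e) :
    Monotone fun i => e i - i := by
  intro i j hij
  have hcard : #(Ioc i j) ≤ #(Ioc (e i) (e j)) := by
    refine card_le_card_of_injOn e (fun a ha => ?_) he.injective.injOn
    obtain ⟨hia, haj⟩ := mem_Ioc.1 ha
    exact mem_coe.2 (mem_Ioc.2 ⟨he hia, he.monotone haj⟩)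
  rw [Fin.card_Ioc, Nat.card_Ioc] at hcard
  have := he.monotone hij
  have : (i : ℕ) ≤ j := hij
  dsimp only
  omega

theorem val_lt_of_strictMono_of_pos {k : ℕ} {e : Fin k → ℕ} (he : StrictMono e)
    (hpos : ∀ i, 0 < e i) (i : Fin k) : (i : ℕ) < e i := by
  have hmono := monotone_sub_val_of_strictMono he (Fin.mk_le_of_le_val (Nat.zero_le i) :
    ⟨0, i.pos⟩ ≤ i)
  have := hpos ⟨0, i.pos⟩
  dsimp only at hmono
  omega

theorem exists_rowLen_eq {k : ℕ} {w : Fin k → ℕ} (hw : Antitone w) (hpos : ∀ i, 0 < w i) :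
    ∃ μ : YoungDiagram, μ.colLen 0 = k ∧ ∀ i : Fin k, μ.rowLen i = w i := by
  have hsorted : (List.ofFn w).SortedGE := hw.sortedGE_ofFn
  refine ⟨ofRowLens _ hsorted, ?_, fun i => ?_⟩
  · rw [← length_rowLens, rowLens_length_ofRowLens, List.length_ofFn]
    simpa [List.mem_ofFn] using hpos
  · have := rowLen_ofRowLens (hw := hsorted) (i.cast (List.length_ofFn).symm)
    simpa using this

theorem exists_betaSet_eq {X : Finset ℕ} (hX : 0 ∉ X) : ∃ μ : YoungDiagram, betaSet μ = X := by
  set e := X.orderEmbOfFin rfl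
  have hpos (i : Fin #X) : 0 < e i :=
    Nat.pos_of_ne_zero fun h => hX (h ▸ X.orderEmbOfFin_mem rfl i)
  have hlt := val_lt_of_strictMono_of_pos e.strictMono hpos
  obtain ⟨μ, hcol, hrow⟩ := exists_rowLen_eq (w := fun i => e i.rev - i.rev)
    ((monotone_sub_val_of_strictMono e.strictMono).comp_antitone Fin.rev_anti)
    fun i => Nat.sub_pos_of_lt (hlt i.rev)
  refine ⟨μ, eq_of_subset_of_card_le (fun x hx => ?_) (by rw [card_betaSet, hcol])⟩
  obtain ⟨i, hi, rfl⟩ := mem_betaSet.1 hx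
  have hook : μ.hookLength i 0 = e (Fin.rev ⟨i, hcol ▸ hi⟩) := by
    have := hookLength_zero_add hi
    have := hrow ⟨i, hcol ▸ hi⟩
    have := hlt (Fin.rev ⟨i, hcol ▸ hi⟩)
    simp only [Fin.val_rev] at *
    omega
  exact hook ▸ X.orderEmbOfFin_mem rfl _

/-- The number attached to column `j`: these are exactly the non-elements of `betaSet μ`. -/
def columnGap (μ : YoungDiagram) (j : ℕ) : ℕ := μ.colLen 0 - μ.colLen j + j

theorem hookLength_add_columnGap (h : (i, j) ∈ μ) :
    μ.hookLength i j + columnGap μ j = μ.hookLength i 0 := by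
  have := mem_iff_lt_rowLen.1 h
  have := mem_iff_lt_colLen.1 h
  have := μ.colLen_anti 0 j (Nat.zero_le j)
  unfold hookLength columnGap
  omega

theorem columnGap_lt_hookLength_zero_iff (hi : i < μ.colLen 0) :
    columnGap μ j < μ.hookLength i 0 ↔ (i, j) ∈ μ := by
  have := lt_rowLen_iff_lt_colLen (μ := μ) (i := i) (j := j)
  have := μ.colLen_anti 0 j (Nat.zero_le j)
  have := hookLength_zero_add hi
  rw [mem_iff_lt_rowLen, columnGap]
  omega

theorem columnGap_notMem_betaSet (μ : YoungDiagram) (j : ℕ) : columnGap μ j ∉ betaSet μ := by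
  rw [mem_betaSet]
  rintro ⟨i, hi, h⟩
  have := lt_rowLen_iff_lt_colLen (μ := μ) (i := i) (j := j)
  have := μ.colLen_anti 0 j (Nat.zero_le j)
  have := hookLength_zero_add hi
  unfold columnGap at h
  omega

theorem exists_columnGap_eq {x : ℕ} (hx : x ∉ betaSet μ) : ∃ j, columnGap μ j = x := by
  obtain ⟨j, hj, hj'⟩ : ∃ j, columnGap μ j ≤ x ∧ x < columnGap μ (j + 1) := by
    have hzero : ¬x < columnGap μ 0 := by simp [columnGap]
    obtain ⟨j, hj, hj'⟩ := Nat.exists_not_and_succ_of_not_zero_of_exists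
      (p := fun j => x < columnGap μ j) hzero
      ⟨x + 1, by unfold columnGap; omega⟩
    exact ⟨j, not_lt.1 hj, hj'⟩
  refine ⟨j, by_contra fun hne => hx ?_⟩
  unfold columnGap at hj hj' hne
  have := μ.colLen_anti 0 j (Nat.zero_le j)
  have hi : μ.colLen 0 + j - x < μ.colLen 0 := by omega
  have hook := hookLength_zero_add hi
  have := lt_rowLen_iff_lt_colLen (μ := μ) (i := μ.colLen 0 + j - x) (j := j)
  have := lt_rowLen_iff_lt_colLen (μ := μ) (i := μ.colLen 0 + j - x) (j := j + 1)
  exact mem_betaSet.2 ⟨μ.colLen 0 + j - x, hi, by omega⟩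

theorem mem_of_add_mul_mem {X : Finset ℕ} {t : ℕ} (hX : ∀ x, x + t ∈ X → x ∈ X) {x : ℕ} :
    ∀ m, x + t * m ∈ X → x ∈ X
  | 0, h => h
  | m + 1, h => mem_of_add_mul_mem hX m (hX _ (by rwa [mul_add_one, ← add_assoc] at h))

theorem isCore_iff_betaSet {t : ℕ} : μ.IsCore t ↔ ∀ x, x + t ∈ betaSet μ → x ∈ betaSet μ := by
  constructor
  · intro hcore x hx
    by_contra hgap
    obtain ⟨j, rfl⟩ := exists_columnGap_eq hgap
    obtain ⟨i, hi, hook⟩ := mem_betaSet.1 hx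
    have ht : t ≠ 0 := by
      rintro rfl
      exact hgap hx
    have hij := (columnGap_lt_hookLength_zero_iff (j := j) hi).1 (by omega)
    have := hookLength_add_columnGap hij
    exact hcore i j hij ⟨1, by omega⟩
  · rintro hclosed i j hij ⟨m, hm⟩
    refine columnGap_notMem_betaSet μ j (mem_of_add_mul_mem hclosed m (mem_betaSet.2 ?_))
    refine ⟨i, mem_iff_lt_colLen.1 (μ.up_left_mem le_rfl (Nat.zero_le j) hij), ?_⟩
    rw [← hm, add_comm, hookLength_add_columnGap hij]

end BetaSets

section Abacus

variable {t : ℕ}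

theorem injective_mul_add_val : Function.Injective fun s : (_ : Fin t) × ℕ => t * s.2 + s.1 := by
  rintro ⟨r, a⟩ ⟨r', a'⟩ h
  have hr : r = r' := Fin.ext <| by
    simpa [Nat.mod_eq_of_lt r.2, Nat.mod_eq_of_lt r'.2] using congrArg (· % t) h
  subst hr
  have ha : a = a' := Nat.eq_of_mul_eq_mul_left r.pos (Nat.add_right_cancel h)
  rw [ha]

/-- The set whose elements congruent to `r` modulo `t` are the `f r` smallest ones, i.e. the
abacus with `t` runners in which the `f r` beads of runner `r` are pushed to the top. -/
def abacus (f : Fin t → ℕ) : Finset ℕ :=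
  (univ.sigma fun r => range (f r)).image fun s => t * s.2 + s.1

theorem mul_add_val_mem_abacus {f : Fin t → ℕ} {r : Fin t} {a : ℕ} :
    t * a + r ∈ abacus f ↔ a < f r := by
  have hmem := injective_mul_add_val.mem_finset_image
    (s := univ.sigma fun r => range (f r)) (a := ⟨r, a⟩)
  rw [mem_sigma, mem_range] at hmem
  exact hmem.trans (and_iff_right (mem_univ r))

theorem sum_abacus (f : Fin t → ℕ) (g : ℕ → ℕ) :
    ∑ x ∈ abacus f, g x = ∑ r, ∑ a ∈ range (f r), g (t * a + r) := by
  rw [abacus, sum_image injective_mul_add_val.injOn, sum_sigma]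

theorem card_abacus (f : Fin t → ℕ) : #(abacus f) = ∑ r, f r := by
  rw [card_eq_sum_ones, sum_abacus]
  simp only [sum_const, card_range, smul_eq_mul, mul_one]

theorem abacus_injective : Function.Injective (abacus : (Fin t → ℕ) → Finset ℕ) := by
  intro f g h
  funext r
  refine eq_of_forall_lt_iff fun a => ?_
  rw [← mul_add_val_mem_abacus, h, mul_add_val_mem_abacus]

theorem mem_abacus_of_add_mem {f : Fin t → ℕ} {x : ℕ} (hx : x + t ∈ abacus f) : x ∈ abacus f := by
  obtain rfl | ht := t.eq_zero_or_pos
  · exact hx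
  · have hdiv : x = t * (x / t) + (⟨x % t, x.mod_lt ht⟩ : Fin t) := (Nat.div_add_mod x t).symm
    rw [hdiv, add_right_comm, ← mul_add_one, mul_add_val_mem_abacus] at hx
    rw [hdiv, mul_add_val_mem_abacus]
    omega

theorem exists_abacus_eq (ht : 0 < t) {X : Finset ℕ} (hX : ∀ x, x + t ∈ X → x ∈ X) :
    ∃ f : Fin t → ℕ, abacus f = X := by
  have hrunner (r : Fin t) : ∃ k, ∀ a, t * a + r ∈ X ↔ a < k := by
    have hex : ∃ k, t * k + r ∉ X := by
      obtain ⟨N, hN⟩ := X.exists_nat_subset_range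
      refine ⟨N, fun h => (mem_range.1 (hN h)).not_ge ?_⟩
      exact (Nat.le_mul_of_pos_left N ht).trans (Nat.le_add_right _ _)
    refine ⟨Nat.find hex, fun a => ⟨fun ha => ?_, fun ha => not_not.1 (Nat.find_min hex ha)⟩⟩
    by_contra hle
    obtain ⟨m, rfl⟩ := Nat.exists_eq_add_of_le (not_lt.1 hle)
    refine Nat.find_spec hex (mem_of_add_mul_mem hX m ?_)
    rwa [add_right_comm, ← mul_add]
  choose f hf using hrunner
  refine ⟨f, Finset.ext fun x => ?_⟩
  have hdiv : x = t * (x / t) + (⟨x % t, x.mod_lt ht⟩ : Fin t) := (Nat.div_add_mod x t).symm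
  rw [hdiv, mul_add_val_mem_abacus, hf]

/-- The abacus with three runners carrying `0`, `q.1` and `q.2` beads. -/
def threeAbacus (q : ℕ × ℕ) : Finset ℕ := abacus ![0, q.1, q.2]

theorem threeAbacus_injective : Function.Injective threeAbacus := by
  intro q q' h
  have hf := abacus_injective h
  exact Prod.ext (congrFun hf 1) (congrFun hf 2)

theorem zero_notMem_threeAbacus (q : ℕ × ℕ) : 0 ∉ threeAbacus q := by
  simpa [threeAbacus] using (mul_add_val_mem_abacus (f := ![0, q.1, q.2]) (r := 0) (a := 0)).not

theorem exists_threeAbacus_eq_betaSet {μ : YoungDiagram} (hμ : μ.IsCore 3) :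
    ∃ q, threeAbacus q = betaSet μ := by
  obtain ⟨f, hf⟩ := exists_abacus_eq three_pos (isCore_iff_betaSet.1 hμ)
  have hzero : f 0 = 0 := by
    by_contra hne
    refine zero_notMem_betaSet μ ?_
    simpa [hf] using (mul_add_val_mem_abacus (f := f) (r := 0) (a := 0)).2 (by omega)
  refine ⟨(f 1, f 2), ?_⟩
  rw [threeAbacus, ← hf]
  congr 1
  funext r
  fin_cases r <;> simp [hzero]

theorem isCore_three_iff_exists_threeAbacus_eq {μ : YoungDiagram} :
    μ.IsCore 3 ↔ ∃ q, threeAbacus q = betaSet μ := by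
  refine ⟨exists_threeAbacus_eq_betaSet, ?_⟩
  rintro ⟨q, hq⟩
  rw [isCore_iff_betaSet, ← hq]
  exact fun x => mem_abacus_of_add_mem

theorem card_threeAbacus (q : ℕ × ℕ) : #(threeAbacus q) = q.1 + q.2 := by
  simp [threeAbacus, card_abacus, Fin.sum_univ_three]

theorem sum_threeAbacus (q : ℕ × ℕ) :
    ∑ x ∈ threeAbacus q, x =
      3 * ∑ a ∈ range q.1, a + q.1 + (3 * ∑ a ∈ range q.2, a + 2 * q.2) := by
  simp [threeAbacus, sum_abacus, Fin.sum_univ_three, sum_add_distrib, mul_sum, mul_comm 2,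
    add_assoc, add_left_comm]

theorem card_add_mul_eq_of_threeAbacus_eq {μ : YoungDiagram} {q : ℕ × ℕ}
    (h : threeAbacus q = betaSet μ) :
    μ.card + q.1 * q.2 = q.1 ^ 2 + q.2 ^ 2 + q.2 := by
  have gauss (k : ℕ) : 2 * ∑ i ∈ range k, i + k = k ^ 2 := by
    induction k with
    | zero => rfl
    | succ k ih => rw [sum_range_succ]; linarith
  have hsum := sum_betaSet μ
  rw [← card_betaSet, ← h, sum_threeAbacus, card_threeAbacus] at hsum
  linarith [gauss q.1, gauss q.2, gauss (q.1 + q.2)]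

theorem ncard_threeCores (n : ℕ) :
    {μ : YoungDiagram | μ.IsCore 3 ∧ μ.card = n}.ncard =
      {q : ℕ × ℕ | q.1 ^ 2 + q.2 ^ 2 + q.2 = n + q.1 * q.2}.ncard := by
  rw [← Set.ncard_image_of_injective _ betaSet_injective,
    ← Set.ncard_image_of_injective _ threeAbacus_injective]
  congr 1
  ext X
  constructor
  · rintro ⟨μ, ⟨hcore, rfl⟩, rfl⟩
    obtain ⟨q, hq⟩ := isCore_three_iff_exists_threeAbacus_eq.1 hcore
    exact ⟨q, (card_add_mul_eq_of_threeAbacus_eq hq).symm, hq⟩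
  · rintro ⟨q, hq, rfl⟩
    obtain ⟨μ, hμ⟩ := exists_betaSet_eq (zero_notMem_threeAbacus q)
    refine ⟨μ, ⟨isCore_three_iff_exists_threeAbacus_eq.2 ⟨q, hμ.symm⟩, ?_⟩, hμ⟩
    have := card_add_mul_eq_of_threeAbacus_eq hμ.symm
    rw [Set.mem_ofPred_eq] at hq
    omega

end Abacus

section CorePairs

theorem numCorePairs_eq_sum_antidiagonal (t n : ℕ) :
    numCorePairs t n = ∑ q ∈ antidiagonal n,
      {μ : YoungDiagram | μ.IsCore t ∧ μ.card = q.1}.ncard *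
        {μ : YoungDiagram | μ.IsCore t ∧ μ.card = q.2}.ncard := by
  have hsizes : ∀ P ∈ (corePairs_finite t n).toFinset,
      (P.1.card, P.2.card) ∈ antidiagonal n := fun P hP =>
    HasAntidiagonal.mem_antidiagonal.2 ((corePairs_finite t n).mem_toFinset.1 hP).1
  rw [numCorePairs, Set.ncard_eq_toFinset_card _ (corePairs_finite t n),
    card_eq_sum_card_fiberwise hsizes]
  refine sum_congr rfl fun q hq => ?_
  rw [← Set.ncard_prod, ← Set.ncard_coe_finset]
  congr 1
  ext P
  simp only [coe_filter, Set.Finite.mem_toFinset, Set.mem_ofPred_eq, Set.mem_prod, Prod.ext_iff]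
  constructor
  · rintro ⟨⟨-, h1, h2⟩, hq1, hq2⟩
    exact ⟨⟨h1, hq1⟩, h2, hq2⟩
  · rintro ⟨⟨h1, hq1⟩, h2, hq2⟩
    refine ⟨⟨?_, h1, h2⟩, hq1, hq2⟩
    rw [hq1, hq2, HasAntidiagonal.mem_antidiagonal.1 hq]

theorem three_mul_numCorePairs (n : ℕ) : 3 * numCorePairs 3 n = sigma 1 (3 * n + 2) := by
  have h := three_mul_sum_antidiagonal_sum_divisors_three_mul_add_one n
  simp only [← ncard_nat_coreCoordinates, ← ncard_threeCores] at h
  rw [numCorePairs_eq_sum_antidiagonal]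
  exact_mod_cast h

theorem numCorePairs_three_pow {p : ℕ} (hp : p.Prime) {j : ℕ} (hj : j ≠ 0)
    (hpj : p ^ j ≡ 1 [MOD 3]) (k n : ℕ) :
    (numCorePairs 3 ((p ^ j) ^ k * n + (2 * (p ^ j) ^ k - 2) / 3) : ℚ) =
      (((p : ℚ) ^ j) ^ k - 1) / ((p : ℚ) ^ j - 1) *
          numCorePairs 3 (p ^ j * n + (2 * p ^ j - 2) / 3) -
        (((p : ℚ) ^ j) ^ k - (p : ℚ) ^ j) / ((p : ℚ) ^ j - 1) * numCorePairs 3 n := by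
  have hcount (n : ℕ) : (numCorePairs 3 n : ℚ) = sigma 1 (3 * n + 2) / 3 := by
    rw [← three_mul_numCorePairs, Nat.cast_mul, Nat.cast_ofNat,
      mul_div_cancel_left₀ _ three_ne_zero]
  have hindex {P : ℕ} (hP : P ≡ 1 [MOD 3]) :
      3 * (P * n + (2 * P - 2) / 3) + 2 = P * (3 * n + 2) := by
    have hP' : P % 3 = 1 := hP
    have hdiv : 3 * ((2 * P - 2) / 3) + 2 = 2 * P := by omega
    linear_combination hdiv
  have hpjk : (p ^ j) ^ k ≡ 1 [MOD 3] := by simpa only [one_pow] using hpj.pow k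
  rw [hcount, hcount, hcount, hindex hpj, hindex hpjk, sigma_one_prime_pow_pow_mul hp hj]
  ring

end CorePairs

theorem mainTheorem4 (p : ℕ) (hp : p.Prime) (k n : ℕ) :
    (p ≡ 1 [MOD 3] →
      (numCorePairs 3 (p ^ k * n + (2 * p ^ k - 2) / 3) : ℚ) =
        ((p : ℚ) ^ k - 1) / ((p : ℚ) - 1) * (numCorePairs 3 (p * n + (2 * p - 2) / 3) : ℚ) -
          ((p : ℚ) ^ k - (p : ℚ)) / ((p : ℚ) - 1) * (numCorePairs 3 n : ℚ)) ∧
    (p ≡ 2 [MOD 3] →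
      (numCorePairs 3 (p ^ (2 * k) * n + (2 * p ^ (2 * k) - 2) / 3) : ℚ) =
        ((p : ℚ) ^ (2 * k) - 1) / ((p : ℚ) ^ 2 - 1) *
            (numCorePairs 3 (p ^ 2 * n + (2 * p ^ 2 - 2) / 3) : ℚ) -
          ((p : ℚ) ^ (2 * k) - (p : ℚ) ^ 2) / ((p : ℚ) ^ 2 - 1) * (numCorePairs 3 n : ℚ)) := by
  refine ⟨fun h => ?_, fun h => ?_⟩
  · simpa only [pow_one] using
      numCorePairs_three_pow hp one_ne_zero ((pow_one p).symm ▸ h) k n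
  · simpa only [pow_mul] using numCorePairs_three_pow hp two_ne_zero (h.pow 2) k n
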